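/- Let $d\ge 0$ be an integer. For a Borel probability measure $\mu$ on $\mathbb{R}^d$ and $t\ge 0$, let the wet part be \[ W_t^{\mu}=\{x\in\mathbb{R}^d : \text{there is a closed halfspace } h \text{ with } x\in h \text{ and } \mu(h)\le t\}, \] and let $w^{\mu}(t)=\mu(W_t^{\mu})$. Let $P_n^{\mu}$ be the convex hull of $n$ independent random points, each distributed according to $\mu$. Then there is a sequence $\varepsilon_d(n)$ of real numbers, depending only on $d$ (and not on $\mu$), with $\varepsilon_d(n)\to 0$ as $n\to\infty$, such that for every Borel probability measure $\mu$ on $\mathbb{R}^d$ and every integer $n\ge 2$ \[ \tfrac14\, w^{\mu}\bigl(\tfrac1n\bigr)\ \le\ \mathbb{E}\bigl[1-\mu(P_n^{\mu})\bigr]\ \le\ w^{\mu}\bigl((d+2)\tfrac{\ln n}{n}\bigr)+\frac{\varepsilon_d(n)}{n}. \] -/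

import Mathlib

open MeasureTheory Filter Topology

noncomputable section

/-- A closed halfspace of `ℝ^d`: `{x | c ≤ ⟨u, x⟩}` for some nonzero vector `u` and real `c`. -/
def IsClosedHalfspace {d : ℕ} (h : Set (EuclideanSpace ℝ (Fin d))) : Prop :=
  ∃ u : EuclideanSpace ℝ (Fin d), u ≠ 0 ∧ ∃ c : ℝ, h = {x | c ≤ inner ℝ u x}

/-- The wet part of `μ` with parameter `t`: the union of all closed halfspaces of `μ`-measure
at most `t`. -/
def wetPart {d : ℕ} (μ : Measure (EuclideanSpace ℝ (Fin d))) (t : ℝ) :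
    Set (EuclideanSpace ℝ (Fin d)) :=
  {x | ∃ h : Set (EuclideanSpace ℝ (Fin d)), IsClosedHalfspace h ∧ x ∈ h ∧ μ.real h ≤ t}

/-- The `μ`-measure of the wet part. -/
def wetMeasure {d : ℕ} (μ : Measure (EuclideanSpace ℝ (Fin d))) (t : ℝ) : ℝ :=
  μ.real (wetPart μ t)

/-- The law of a sample of `n` independent points of `ℝ^d`, each distributed according to `μ`. -/
def sampleLaw {d : ℕ} (μ : Measure (EuclideanSpace ℝ (Fin d))) (n : ℕ) :
    Measure (Fin n → EuclideanSpace ℝ (Fin d)) :=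
  Measure.pi fun _ => μ

/-- The polytope spanned by a sample: the convex hull of its points. -/
def samplePolytope {d n : ℕ} (X : Fin n → EuclideanSpace ℝ (Fin d)) :
    Set (EuclideanSpace ℝ (Fin d)) :=
  convexHull ℝ (Set.range X)

end

/-! ### Nearest points of convex hulls and the sample points that determine them. -/

section Geometry

variable {E : Type*} [NormedAddCommGroup E] [InnerProductSpace ℝ E] {n : ℕ}

/-! By Tonelli, the expectation is the `μ`-average of the probability that the polytope misses `x`.
Lower bound: if `x` lies in a halfspace of mass at most `1/n`, all points avoid that halfspace with
probability at least `(1 - 1/n)^n ≥ 1/4`, and then `x` is missed. Upper bound: if `x` is missed, the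
hull's nearest point `p` to `x` is a combination of `d` sample points (`exists_mem_supportEvent`).
Fixing these fixes `p`, hence a halfspace with `x` on its boundary that every other point must avoid
(`exists_halfspace_of_supportEvent`). For `x` outside the wet part its mass exceeds `t`, so a union
bound over index sets gives `n^d * exp(-t)^(n-d)`, which is `O(1/n^2)` at `t = (d+2) ln n / n`. -/

theorem mem_convexHull_range_iff_exists_stdSimplex {X : Fin n → E} {x : E} :
    x ∈ convexHull ℝ (Set.range X) ↔ ∃ w ∈ stdSimplex ℝ (Fin n), ∑ i, w i • X i = x := by
  have hX : Set.range X = Fintype.linearCombination ℝ X ''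
      Set.range (fun i => (Pi.single i 1 : Fin n → ℝ)) := by
    rw [← Set.range_comp]
    congr 1
    ext i
    simp [Fintype.linearCombination_apply_single]
  rw [hX, ← LinearMap.image_convexHull, convexHull_rangle_single_eq_stdSimplex]
  simp [Fintype.linearCombination_apply]

theorem isClosed_mem_convexHull_range :
    IsClosed {q : E × (Fin n → E) | q.1 ∈ convexHull ℝ (Set.range q.2)} := by
  have h : IsClosed {r : stdSimplex ℝ (Fin n) × (E × (Fin n → E)) |
      ∑ i, r.1.1 i • r.2.2 i = r.2.1} := by
    refine isClosed_eq (continuous_finsetSum _ fun i _ => ?_) (by fun_prop)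
    exact ((continuous_apply i).comp (continuous_subtype_val.comp continuous_fst)).smul
      (by fun_prop)
  convert isClosedMap_snd_of_compactSpace _ h
  ext q
  simp [mem_convexHull_range_iff_exists_stdSimplex]

/-- The samples `X` whose convex hull misses `x`, and whose point closest to `x` is a convex
combination of the sample points with index in `I`. -/
def supportEvent (x : E) (I : Finset (Fin n)) : Set (Fin n → E) :=
  {X | x ∉ convexHull ℝ (Set.range X) ∧ ∃ w ∈ stdSimplex ℝ (Fin n), (∀ i ∉ I, w i = 0) ∧
    ∀ j, 0 ≤ inner ℝ (∑ i, w i • X i - x) (X j - ∑ i, w i • X i)}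

/-- An open set meets the projection, along the compact simplex of weights, of a closed set. -/
theorem measurableSet_supportEvent [MeasurableSpace E] [BorelSpace E]
    [SecondCountableTopology E] (x : E) (I : Finset (Fin n)) :
    MeasurableSet (supportEvent x I) := by
  have hO : IsOpen {X : Fin n → E | x ∉ convexHull ℝ (Set.range X)} :=
    ((isClosed_mem_convexHull_range (E := E) (n := n)).preimage
      (Continuous.prodMk_right x)).isOpen_compl
  have hw (i : Fin n) : Continuous
      fun r : stdSimplex ℝ (Fin n) × (Fin n → E) => r.1.1 i :=
    (continuous_apply i).comp (continuous_subtype_val.comp continuous_fst)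
  have hs : Continuous fun r : stdSimplex ℝ (Fin n) × (Fin n → E) => ∑ i, r.1.1 i • r.2 i :=
    continuous_finsetSum _ fun i _ => (hw i).smul (by fun_prop)
  have h : IsClosed {r : stdSimplex ℝ (Fin n) × (Fin n → E) | (∀ i ∉ I, r.1.1 i = 0) ∧
      ∀ j, 0 ≤ inner ℝ (∑ i, r.1.1 i • r.2 i - x) (r.2 j - ∑ i, r.1.1 i • r.2 i)} := by
    simp only [Set.ofPred_and, Set.ofPred_forall]
    refine IsClosed.inter (isClosed_iInter fun i => isClosed_iInter fun _ =>
      isClosed_eq (hw i) continuous_const) (isClosed_iInter fun j => ?_)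
    exact isClosed_le continuous_const ((hs.sub continuous_const).inner
      (Continuous.sub (by fun_prop) hs))
  have hC := isClosedMap_snd_of_compactSpace _ h
  convert hO.measurableSet.inter hC.measurableSet
  ext X
  simp [supportEvent, and_left_comm]

theorem sum_smul_inner_nonneg {w : Fin n → ℝ} (hw : w ∈ stdSimplex ℝ (Fin n)) {X : Fin n → E}
    {u p : E} (h : ∀ j, w j ≠ 0 → 0 ≤ inner ℝ u (X j - p)) :
    0 ≤ inner ℝ u (∑ i, w i • X i - p) := by
  have : ∑ i, w i • X i - p = ∑ i, w i • (X i - p) := by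
    simp [smul_sub, Finset.sum_sub_distrib, ← Finset.sum_smul, hw.2]
  rw [this, inner_sum]
  refine Finset.sum_nonneg fun i _ => ?_
  rw [inner_smul_right]
  by_cases hi : w i = 0
  · simp [hi]
  · exact mul_nonneg (hw.1 i) (h i hi)

/-- Samples in `supportEvent x I` that agree on `I` all lie strictly on one side of a common
hyperplane through `x`. -/
theorem exists_halfspace_of_supportEvent (x : E) (I : Finset (Fin n)) {X₀ : Fin n → E}
    (h₀ : X₀ ∈ supportEvent x I) :
    ∃ u : E, u ≠ 0 ∧ ∀ X ∈ supportEvent x I, (∀ i ∈ I, X i = X₀ i) →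
      ∀ j, inner ℝ u (X j) < inner ℝ u x := by
  obtain ⟨hx₀, w₀, hw₀, hI₀, hin₀⟩ := h₀
  set p₀ := ∑ i, w₀ i • X₀ i with hp₀
  have hne : x - p₀ ≠ 0 := by
    rw [sub_ne_zero]
    rintro rfl
    exact hx₀ (mem_convexHull_range_iff_exists_stdSimplex.2 ⟨w₀, hw₀, rfl⟩)
  refine ⟨x - p₀, hne, ?_⟩
  rintro X ⟨hx, w, hw, hI, hin⟩ hag j
  set p := ∑ i, w i • X i with hp
  have e₀ : p₀ = ∑ i, w₀ i • X i := by
    refine Finset.sum_congr rfl fun i _ => ?_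
    by_cases hi : i ∈ I
    · rw [hag i hi]
    · simp [hI₀ i hi]
  have e₁ : p = ∑ i, w i • X₀ i := by
    refine Finset.sum_congr rfl fun i _ => ?_
    by_cases hi : i ∈ I
    · rw [hag i hi]
    · simp [hI i hi]
  have h1 : 0 ≤ inner ℝ (p - x) (p₀ - p) := by
    rw [e₀]; exact sum_smul_inner_nonneg hw₀ fun j _ => hin j
  have h2 : 0 ≤ inner ℝ (p₀ - x) (p - p₀) := by
    rw [e₁]; exact sum_smul_inner_nonneg hw fun j _ => hin₀ j
  -- Each of `p`, `p₀` combines points of both samples; adding the two variational inequalities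
  -- gives `‖p - p₀‖² ≤ 0`.
  have h3 : p = p₀ := by
    have : inner ℝ (p - p₀) (p - p₀) ≤ 0 := by
      simp only [inner_sub_left, inner_sub_right] at h1 h2 ⊢
      linarith
    exact sub_eq_zero.1 (inner_self_eq_zero.1 (this.antisymm real_inner_self_nonneg))
  have h4 := hin j
  have h5 : 0 < inner ℝ (x - p₀) (x - p₀) := real_inner_self_pos.2 hne
  rw [h3] at h4
  simp only [inner_sub_left, inner_sub_right] at h4 h5 ⊢
  linarith [real_inner_comm x p₀, real_inner_comm (X j) p₀]

theorem exists_mem_supportEvent [FiniteDimensional ℝ E] (hn : 0 < n)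
    (hd : Module.finrank ℝ E ≤ n) {x : E} {X : Fin n → E}
    (hx : x ∉ convexHull ℝ (Set.range X)) :
    ∃ I : Finset (Fin n), I.card = Module.finrank ℝ E ∧ X ∈ supportEvent x I := by
  have hne : (convexHull ℝ (Set.range X)).Nonempty := ⟨X ⟨0, hn⟩, subset_convexHull ℝ _ ⟨_, rfl⟩⟩
  have hcv := convex_convexHull ℝ (Set.range X)
  have hcl : IsComplete (convexHull ℝ (Set.range X)) :=
    (Set.finite_range X).isCompact_convexHull ℝ |>.isComplete
  obtain ⟨p, hp, hmin⟩ := exists_norm_eq_iInf_of_complete_convex hne hcl hcv x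
  have hin := (norm_eq_iInf_iff_real_inner_le_zero hcv hp).1 hmin
  have hin' (y : E) (hy : y ∈ Set.range X) : 0 ≤ inner ℝ (p - x) (y - p) := by
    have := hin y (subset_convexHull ℝ _ hy)
    rw [← neg_sub, inner_neg_left]
    linarith
  obtain ⟨ι, _, z, w, hz, hai, hw, hw1, hwp⟩ := eq_pos_convex_span_of_mem_convexHull hp
  have hpx : p ≠ x := by rintro rfl; exact hx hp
  have hort (i : ι) : inner ℝ (p - x) (z i - p) = 0 := by
    have hs : ∑ i, w i * inner ℝ (p - x) (z i - p) = 0 := by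
      simp_rw [← inner_smul_right, ← inner_sum, smul_sub, Finset.sum_sub_distrib,
        ← Finset.sum_smul, hw1, hwp]
      simp
    rw [Finset.sum_eq_zero_iff_of_nonneg
      fun i _ => mul_nonneg (hw i).le (hin' _ (hz ⟨i, rfl⟩))] at hs
    exact (mul_eq_zero.1 (hs i (Finset.mem_univ i))).resolve_left (hw i).ne'
  have hcard : Fintype.card ι ≤ Module.finrank ℝ E := by
    have h1 := hai.card_le_finrank_succ
    have h2 : Module.finrank ℝ (vectorSpan ℝ (Set.range z)) ≤ Module.finrank ℝ E :=
      Submodule.finrank_le _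
    -- With `d + 1` affinely independent points, `x` would lie in their span, but they all lie in
    -- the hyperplane through `p` orthogonal to `p - x`, which misses `x`.
    by_contra hlt
    have htop := hai.affineSpan_eq_top_iff_card_eq_finrank_add_one.2 (by omega)
    obtain ⟨v, hv1, hv⟩ := eq_affineCombination_of_mem_affineSpan_of_fintype
      (htop ▸ AffineSubspace.mem_top ℝ E x : x ∈ affineSpan ℝ (Set.range z))
    rw [Finset.affineCombination_eq_linear_combination _ _ _ hv1] at hv
    have hs : inner ℝ (p - x) (x - p) = 0 := by
      have : x - p = ∑ i, v i • (z i - p) := by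
        simp_rw [smul_sub, Finset.sum_sub_distrib, ← Finset.sum_smul, hv1, ← hv]
        simp
      rw [this, inner_sum]
      exact Finset.sum_eq_zero fun i _ => by rw [inner_smul_right, hort, mul_zero]
    rw [← neg_sub x p, inner_neg_left, neg_eq_zero, inner_self_eq_zero, sub_eq_zero] at hs
    exact hpx hs.symm
  choose f hf using fun i => hz ⟨i, rfl⟩
  classical
  -- Pad to exactly `d` indices; the extra ones get weight zero.
  obtain ⟨I, hfI, hI⟩ := Finset.exists_superset_card_eq (s := Finset.univ.image f)
    (Finset.card_image_le.trans hcard) (by simpa using hd)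
  have hsum : ∑ j, (∑ i with f i = j, w i) • X j = p := by
    rw [← hwp, ← Finset.sum_fiberwise (s := Finset.univ) (g := f)]
    refine Finset.sum_congr rfl fun j _ => ?_
    rw [Finset.sum_smul]
    refine Finset.sum_congr rfl fun i hi => ?_
    rw [← hf i, (Finset.mem_filter.1 hi).2]
  refine ⟨I, hI, hx, fun j => ∑ i with f i = j, w i,
    ⟨fun j => Finset.sum_nonneg fun i _ => (hw i).le, ?_⟩, fun j hj => ?_, fun j => ?_⟩
  · rw [← hw1, ← Finset.sum_fiberwise (s := Finset.univ) (g := f)]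
  · refine Finset.sum_eq_zero fun i hi => absurd ?_ hj
    exact hfI (by simpa using ⟨i, (Finset.mem_filter.1 hi).2⟩)
  · simp only [hsum]
    exact hin' _ ⟨j, rfl⟩

end Geometry

/-! ### Probability bounds for missing a point. -/

section Probability

variable {d n : ℕ} {μ : Measure (EuclideanSpace ℝ (Fin d))}

instance isProbabilityMeasure_sampleLaw [IsProbabilityMeasure μ] :
    IsProbabilityMeasure (sampleLaw μ n) := by
  unfold sampleLaw; infer_instance

theorem measurableSet_notMem_samplePolytope :
    MeasurableSet {q : EuclideanSpace ℝ (Fin d) × (Fin n → EuclideanSpace ℝ (Fin d)) |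
      q.1 ∉ samplePolytope q.2} :=
  isClosed_mem_convexHull_range.isOpen_compl.measurableSet

theorem measurableSet_samplePolytope (X : Fin n → EuclideanSpace ℝ (Fin d)) :
    MeasurableSet (samplePolytope X) :=
  ((Set.finite_range X).isClosed_convexHull ℝ).measurableSet

theorem one_sub_measureReal_samplePolytope [IsProbabilityMeasure μ]
    (X : Fin n → EuclideanSpace ℝ (Fin d)) :
    1 - μ.real (samplePolytope X) = (μ {x | x ∉ samplePolytope X}).toReal :=
  (probReal_compl_eq_one_sub (measurableSet_samplePolytope X)).symm

theorem measurable_measure_notMem_samplePolytope [IsProbabilityMeasure μ] :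
    Measurable fun X : Fin n → EuclideanSpace ℝ (Fin d) => μ {x | x ∉ samplePolytope X} :=
  measurable_measure_prodMk_right measurableSet_notMem_samplePolytope

theorem measurable_sampleLaw_notMem_samplePolytope [IsProbabilityMeasure μ] :
    Measurable fun x => sampleLaw μ n {X | x ∉ samplePolytope X} :=
  measurable_measure_prodMk_left measurableSet_notMem_samplePolytope

theorem integrable_one_sub_measureReal_samplePolytope [IsProbabilityMeasure μ] :
    Integrable (fun X => 1 - μ.real (samplePolytope X)) (sampleLaw μ n) := by
  simp only [one_sub_measureReal_samplePolytope]
  refine Integrable.of_bound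
    measurable_measure_notMem_samplePolytope.ennreal_toReal.aestronglyMeasurable 1
    (Eventually.of_forall fun X => ?_)
  rw [Real.norm_of_nonneg ENNReal.toReal_nonneg]
  exact measureReal_le_one

/-- By Tonelli, the expected missed mass is the average over `x` of the probability that the
sample polytope misses `x`. -/
theorem ofReal_integral_one_sub_measureReal_samplePolytope [IsProbabilityMeasure μ] :
    ENNReal.ofReal (∫ X, (1 - μ.real (samplePolytope X)) ∂(sampleLaw μ n)) =
      ∫⁻ x, sampleLaw μ n {X | x ∉ samplePolytope X} ∂μ := by
  rw [ofReal_integral_eq_lintegral_ofReal integrable_one_sub_measureReal_samplePolytope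
    (Eventually.of_forall fun X => by simp [measureReal_le_one])]
  simp only [one_sub_measureReal_samplePolytope, ENNReal.ofReal_toReal (measure_ne_top μ _)]
  exact (Measure.prod_apply_symm (μ := μ) (ν := sampleLaw μ n)
    measurableSet_notMem_samplePolytope).symm.trans
    (Measure.prod_apply measurableSet_notMem_samplePolytope)

theorem quarter_le_one_sub_inv_pow (hn : 2 ≤ n) : 1 / 4 ≤ (1 - 1 / (n : ℝ)) ^ n := by
  have hn' : (2 : ℝ) ≤ n := by exact_mod_cast hn
  have hinv : 1 / (n : ℝ) ≤ 1 := by rw [div_le_one (by linarith)]; linarith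
  -- Bernoulli with exponent `n/2 ≥ 1` gives `1/2`, which is then squared.
  have h := one_add_mul_self_le_rpow_one_add (s := -(1 / (n : ℝ))) (by linarith)
    (p := n / 2) (by linarith)
  have h1 : 1 + (n : ℝ) / 2 * -(1 / (n : ℝ)) = 1 / 2 := by field_simp; norm_num
  rw [h1] at h
  have h2 : (1 - 1 / (n : ℝ)) ^ n = ((1 + -(1 / (n : ℝ))) ^ ((n : ℝ) / 2)) ^ 2 := by
    rw [← Real.rpow_natCast _ 2, ← Real.rpow_mul (by linarith), ← Real.rpow_natCast]
    push_cast
    congr 1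
    ring
  rw [h2]
  nlinarith

theorem IsClosedHalfspace.measurableSet {h : Set (EuclideanSpace ℝ (Fin d))}
    (hh : IsClosedHalfspace h) : MeasurableSet h := by
  obtain ⟨u, -, c, rfl⟩ := hh
  exact (isClosed_le continuous_const (by fun_prop)).measurableSet

theorem IsClosedHalfspace.convex_compl {h : Set (EuclideanSpace ℝ (Fin d))}
    (hh : IsClosedHalfspace h) : Convex ℝ hᶜ := by
  obtain ⟨u, -, c, rfl⟩ := hh
  have : {x : EuclideanSpace ℝ (Fin d) | c ≤ inner ℝ u x}ᶜ = {x | innerₛₗ ℝ u x < c} := by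
    ext x; simp
  rw [this]
  exact convex_halfSpace_lt (innerₛₗ ℝ u).isLinear c

theorem quarter_le_sampleLaw_of_mem_wetPart [IsProbabilityMeasure μ] (hn : 2 ≤ n)
    {x : EuclideanSpace ℝ (Fin d)} (hx : x ∈ wetPart μ (1 / (n : ℝ))) :
    ENNReal.ofReal (1 / 4) ≤ sampleLaw μ n {X | x ∉ samplePolytope X} := by
  obtain ⟨h, hh, hxh, hμ⟩ := hx
  have hsub : Set.univ.pi (fun _ : Fin n => hᶜ) ⊆ {X | x ∉ samplePolytope X} := by
    intro X hX hxX
    exact convexHull_min (Set.range_subset_iff.2 fun i => hX i trivial) hh.convex_compl hxX hxh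
  refine le_trans ?_ (measure_mono hsub)
  rw [sampleLaw, Measure.pi_pi, Finset.prod_const, Finset.card_univ, Fintype.card_fin,
    ← ofReal_measureReal (μ := μ) (s := hᶜ), ← ENNReal.ofReal_pow measureReal_nonneg,
    probReal_compl_eq_one_sub hh.measurableSet]
  refine ENNReal.ofReal_le_ofReal ((quarter_le_one_sub_inv_pow hn).trans ?_)
  have hn' : (2 : ℝ) ≤ n := by exact_mod_cast hn
  have hinv : 1 / (n : ℝ) ≤ 1 := by rw [div_le_one (by linarith)]; linarith
  exact pow_le_pow_left₀ (by linarith) (by linarith) n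

theorem quarter_mul_wetMeasure_le [IsProbabilityMeasure μ] (hn : 2 ≤ n) :
    1 / 4 * wetMeasure μ (1 / (n : ℝ)) ≤
      ∫ X, (1 - μ.real (samplePolytope X)) ∂(sampleLaw μ n) := by
  rw [← ENNReal.ofReal_le_ofReal_iff
    (integral_nonneg fun X => by simp [measureReal_le_one]),
    ofReal_integral_one_sub_measureReal_samplePolytope, ENNReal.ofReal_mul (by norm_num),
    wetMeasure, ofReal_measureReal]
  refine le_trans ?_ (mul_meas_ge_le_lintegral measurable_sampleLaw_notMem_samplePolytope
    (ENNReal.ofReal (1 / 4)))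
  gcongr
  exact fun x hx => quarter_le_sampleLaw_of_mem_wetPart hn hx

/-- Condition on the points indexed by `I`: the halfspace is then fixed, and the other points avoid
it independently. -/
theorem sampleLaw_supportEvent_le [IsProbabilityMeasure μ] {t : ℝ}
    {x : EuclideanSpace ℝ (Fin d)} (hx : x ∉ wetPart μ t) (I : Finset (Fin n)) :
    sampleLaw μ n (supportEvent x I) ≤ ENNReal.ofReal (Real.exp (-t)) ^ (n - I.card) := by
  have hpres := measurePreserving_piEquivPiSubtypeProd (fun _ : Fin n => μ) (· ∈ I)
  rw [sampleLaw, ← hpres.symm.measure_preimage_equiv, Measure.prod_apply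
    ((MeasurableEquiv.measurable _) (measurableSet_supportEvent x I))]
  refine (lintegral_mono (g := fun _ => ENNReal.ofReal (Real.exp (-t)) ^ (n - I.card))
    fun a => ?_).trans (by simp)
  set e := MeasurableEquiv.piEquivPiSubtypeProd
    (fun _ : Fin n => EuclideanSpace ℝ (Fin d)) (· ∈ I)
  rcases Set.eq_empty_or_nonempty (Prod.mk a ⁻¹' (e.symm ⁻¹' supportEvent x I)) with h | ⟨b₀, hb₀⟩
  · simp [h]
  obtain ⟨u, hu, hall⟩ := exists_halfspace_of_supportEvent x I hb₀
  have hH : IsClosedHalfspace {y : EuclideanSpace ℝ (Fin d) | inner ℝ u x ≤ inner ℝ u y} :=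
    ⟨u, hu, _, rfl⟩
  have hsub : Prod.mk a ⁻¹' (e.symm ⁻¹' supportEvent x I) ⊆
      Set.univ.pi fun _ => {y | inner ℝ u x ≤ inner ℝ u y}ᶜ := by
    intro b hb j _
    have := hall _ hb (fun i hi => by simp [e, hi]) j
    simpa [e, Equiv.piEquivPiSubtypeProd, j.2] using this
  refine (measure_mono hsub).trans ?_
  rw [Measure.pi_pi, Finset.prod_const, Finset.card_univ, Fintype.card_subtype_compl,
    Fintype.card_fin, Fintype.card_coe]
  refine pow_le_pow_left' ?_ _
  rw [← ofReal_measureReal (μ := μ), probReal_compl_eq_one_sub hH.measurableSet]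
  refine ENNReal.ofReal_le_ofReal ?_
  have ht : t < μ.real {y : EuclideanSpace ℝ (Fin d) | inner ℝ u x ≤ inner ℝ u y} := by
    by_contra hle
    exact hx ⟨_, hH, le_refl (inner ℝ u x), not_lt.1 hle⟩
  linarith [Real.one_sub_le_exp_neg t]

theorem sampleLaw_notMem_samplePolytope_le [IsProbabilityMeasure μ] (hn : 0 < n) (hd : d ≤ n)
    {t : ℝ} {x : EuclideanSpace ℝ (Fin d)} (hx : x ∉ wetPart μ t) :
    sampleLaw μ n {X | x ∉ samplePolytope X} ≤
      ENNReal.ofReal (n ^ d * Real.exp (-t) ^ (n - d)) := by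
  have hcov : {X : Fin n → EuclideanSpace ℝ (Fin d) | x ∉ samplePolytope X} ⊆
      ⋃ I ∈ Finset.powersetCard d (Finset.univ : Finset (Fin n)), supportEvent x I := by
    intro X hX
    obtain ⟨I, hI, hXI⟩ := exists_mem_supportEvent hn (by simpa using hd) hX
    simp only [Set.mem_iUnion]
    exact ⟨I, by simpa [Finset.mem_powersetCard] using hI, hXI⟩
  calc sampleLaw μ n {X | x ∉ samplePolytope X}
      ≤ ∑ I ∈ Finset.powersetCard d (Finset.univ : Finset (Fin n)),
          sampleLaw μ n (supportEvent x I) :=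
        (measure_mono hcov).trans (measure_biUnion_finset_le _ _)
    _ ≤ ∑ I ∈ Finset.powersetCard d (Finset.univ : Finset (Fin n)),
          ENNReal.ofReal (Real.exp (-t)) ^ (n - d) := by
        refine Finset.sum_le_sum fun I hI => ?_
        have := sampleLaw_supportEvent_le hx I
        rwa [(Finset.mem_powersetCard.1 hI).2] at this
    _ = ENNReal.ofReal (n.choose d * Real.exp (-t) ^ (n - d)) := by
        rw [Finset.sum_const, Finset.card_powersetCard, Finset.card_univ, Fintype.card_fin,
          nsmul_eq_mul, ENNReal.ofReal_mul (by positivity), ENNReal.ofReal_natCast,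
          ENNReal.ofReal_pow (by positivity)]
    _ ≤ _ := by
        gcongr
        exact_mod_cast Nat.choose_le_pow n d

theorem integral_one_sub_measureReal_samplePolytope_le [IsProbabilityMeasure μ] {t δ : ℝ}
    (hδ : 0 ≤ δ) (h : ∀ x ∉ wetPart μ t,
      sampleLaw μ n {X | x ∉ samplePolytope X} ≤ ENNReal.ofReal δ) :
    ∫ X, (1 - μ.real (samplePolytope X)) ∂(sampleLaw μ n) ≤ wetMeasure μ t + δ := by
  rw [wetMeasure, ← ENNReal.ofReal_le_ofReal_iff (add_nonneg measureReal_nonneg hδ),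
    ofReal_integral_one_sub_measureReal_samplePolytope,
    ENNReal.ofReal_add measureReal_nonneg hδ, ofReal_measureReal]
  -- A measurable hull of equal mass avoids proving the wet part measurable.
  set W := toMeasurable μ (wetPart μ t)
  have hW : MeasurableSet W := measurableSet_toMeasurable _ _
  calc ∫⁻ x, sampleLaw μ n {X | x ∉ samplePolytope X} ∂μ
      ≤ ∫⁻ x, (W.indicator 1 x + ENNReal.ofReal δ) ∂μ := by
        refine lintegral_mono fun x => ?_
        by_cases hx : x ∈ W
        · simpa [hx] using le_add_right prob_le_one
        · simpa [hx] using h x fun hx' => hx (subset_toMeasurable _ _ hx')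
    _ = μ (wetPart μ t) + ENNReal.ofReal δ := by
        rw [lintegral_add_right _ measurable_const, lintegral_indicator_one hW,
          measure_toMeasurable]
        simp

theorem pow_mul_exp_log_le (hn : 2 ≤ n) (hd : d ≤ n) :
    (n : ℝ) ^ d * Real.exp (-(((d : ℝ) + 2) * (Real.log n / n))) ^ (n - d) ≤
      Real.exp (d * (d + 2)) / n / n := by
  have hn0 : (0 : ℝ) < n := by positivity
  have hlog : Real.log n ≤ n := (Real.log_le_sub_one_of_pos hn0).trans (by linarith)
  rw [← Real.exp_nat_mul, Nat.cast_sub hd]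
  have hn_exp : (n : ℝ) = Real.exp (Real.log n) := (Real.exp_log hn0).symm
  have h1 : (n : ℝ) ^ d = Real.exp (d * Real.log n) := by
    rw [Real.exp_nat_mul, ← hn_exp]
  have h2 : Real.exp (d * (d + 2)) / n / n = Real.exp (d * (d + 2) - Real.log n - Real.log n) := by
    rw [Real.exp_sub, Real.exp_sub, ← hn_exp]
  rw [h1, h2, ← Real.exp_add, Real.exp_le_exp]
  have h3 : ((n : ℝ) - d) * -(((d : ℝ) + 2) * (Real.log n / n)) =
      -((d + 2) * Real.log n) + d * (d + 2) * (Real.log n / n) := by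
    field_simp; ring
  have h4 : Real.log n / n ≤ 1 := (div_le_one hn0).2 hlog
  have h5 : (d : ℝ) * (d + 2) * (Real.log n / n) ≤ d * (d + 2) * 1 := by gcongr
  rw [h3]
  linarith

/-- For `n ≤ d` the error term alone exceeds any probability. -/
theorem one_le_exp_div_div (hn : 0 < n) (hd : n ≤ d) :
    1 ≤ Real.exp (d * (d + 2)) / n / n := by
  have hn0 : (0 : ℝ) < n := by positivity
  have hnd : (n : ℝ) ≤ d := by exact_mod_cast hd
  rw [div_div, one_le_div (by positivity)]
  nlinarith [Real.add_one_le_exp ((d : ℝ) * (d + 2))]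

end Probability

theorem theorem2 (d : ℕ) :
    ∃ ε : ℕ → ℝ, Tendsto ε atTop (𝓝 0) ∧
      ∀ (μ : Measure (EuclideanSpace ℝ (Fin d))), IsProbabilityMeasure μ →
        ∀ n : ℕ, 2 ≤ n →
          Integrable (fun X => 1 - μ.real (samplePolytope X)) (sampleLaw μ n) ∧
          1 / 4 * wetMeasure μ (1 / (n : ℝ))
            ≤ ∫ X, (1 - μ.real (samplePolytope X)) ∂(sampleLaw μ n) ∧
          ∫ X, (1 - μ.real (samplePolytope X)) ∂(sampleLaw μ n)
            ≤ wetMeasure μ (((d : ℝ) + 2) * (Real.log n / n)) + ε n / n := by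
  refine ⟨fun n => Real.exp (d * (d + 2)) / n, tendsto_const_div_atTop_nhds_zero_nat _,
    fun μ _ n hn => ⟨integrable_one_sub_measureReal_samplePolytope,
      quarter_mul_wetMeasure_le hn, ?_⟩⟩
  refine integral_one_sub_measureReal_samplePolytope_le (by positivity) fun x hx => ?_
  rcases le_total d n with hd | hd
  · exact (sampleLaw_notMem_samplePolytope_le (by omega) hd hx).trans
      (ENNReal.ofReal_le_ofReal (pow_mul_exp_log_le hn hd))
  · exact prob_le_one.trans (ENNReal.one_le_ofReal.2 (one_le_exp_div_div (by omega) hd))
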